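/- Let $d\in\mathbb N$. For $s>0$ let $\phi_s$ be a dimension function with $\phi_s(0)=0$ and $\phi_s(x)=\bigl(\log(1/x)\bigr)^{-s}$ for all sufficiently small $x>0$. For $E\subset\mathbb R^d$ let $$\mathcal H^{\phi_s}(E)=\lim_{\delta\to0}\inf\Bigl\{\sum_i\phi_s(\operatorname{diam}U_i): E\subset\bigcup_i U_i,\ \operatorname{diam}U_i<\delta\Bigr\}$$ (countable covers), and let $$\mathcal P^{\phi_s}(E)=\inf\Bigl\{\sum_i\mathcal P_0^{\phi_s}(E_i):E\subset\bigcup_iE_i\Bigr\}\quad\text{(countable covers)},$$ where $$\mathcal P_0^{\phi_s}(E)=\lim_{\delta\to0}\sup\Bigl\{\sum_i\phi_s(r_i): B(x_i,r_i)\text{ pairwise disjoint closed balls},\ x_i\in E,\ 0<r_i<\delta\Bigr\}.$$ The logarithmic Hausdorff (respectively packing) dimension of $A\subset\mathbb R^d$ is the infimum of all real $s>0$ such that $\mathcal H^{\phi_s}(A)=0$ (respectively $\mathcal P^{\phi_s}(A)=0$), with $\inf\emptyset=\infty$. **Theorem.** Let $A\subset\mathbb R^d$ be a Borel set whose logarithmic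 packing dimension is $>2$ or whose logarithmic Hausdorff dimension is $>1$. Then there is an $F_\sigma$ set $B\subset\mathbb R^d$ of zero Lebesgue measure such that $$f(A)+B=\mathbb R^d\quad\text{for every non-singular (that is, bijective) affine map } f:\mathbb R^d\to\mathbb R^d .$$ Moreover, $\mathbb R^d\setminus(-B)$ is a dense $G_\delta$ set of full Lebesgue measure, and there is no non-singular affine map $f:\mathbb R^d\to\mathbb R^d$ with $f(A)\subset\mathbb R^d\setminus(-B)$. In particular, $A$ is not full-measure universal: it is not true that every set $E\subset\mathbb R^d$ of full Lebesgue measure contains $f(A)$ for some non-singular affine map $f$. -/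

import Mathlib

open MeasureTheory Set
open scoped ENNReal NNReal Pointwise

noncomputable section

/-- The dimension function `x ↦ log⁻ˢ(1/x)` for `0 < x ≤ 1/e`, with value `0` at `0`, extended to
`x ≥ 1/e` (including `∞`) by its value `1` at `1/e`. The measures below depend only on its values
near `0`. -/
def logGauge (s : ℝ) (x : ℝ≥0∞) : ℝ≥0∞ :=
  if x = 0 then 0 else ENNReal.ofReal ((max 1 (Real.log (1 / x.toReal))) ^ (-s))

/-- The Hausdorff (outer) measure with gauge `φ`. -/
def hausdorffGaugeMeasure {X : Type*} [MetricSpace X] [MeasurableSpace X] [BorelSpace X]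
    (φ : ℝ≥0∞ → ℝ≥0∞) (E : Set X) : ℝ≥0∞ :=
  Measure.mkMetric φ E

/-- `P` is a `δ`-packing of `E`: a family of pairwise disjoint closed balls, given by pairs
(centre, radius), with centres in `E` and positive radii less than `δ`. -/
def IsPacking {X : Type*} [MetricSpace X] (δ : ℝ≥0) (E : Set X) (P : Set (X × ℝ≥0)) : Prop :=
  (∀ p ∈ P, p.1 ∈ E ∧ 0 < p.2 ∧ p.2 < δ) ∧
    P.PairwiseDisjoint fun p => Metric.closedBall p.1 (p.2 : ℝ)

/-- The packing pre-measure with gauge `φ`. The supremum of the sums over `δ`-packings is monotone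
in `δ`, so its limit as `δ → 0` is the infimum over `δ > 0`. -/
def packingPreMeasure {X : Type*} [MetricSpace X] (φ : ℝ≥0∞ → ℝ≥0∞) (E : Set X) : ℝ≥0∞ :=
  ⨅ (δ : ℝ≥0) (_ : 0 < δ), ⨆ (P : Set (X × ℝ≥0)) (_ : IsPacking δ E P),
    ∑' p : P, φ ((p : X × ℝ≥0).2 : ℝ≥0∞)

/-- The packing (outer) measure with gauge `φ`. -/
def packingGaugeMeasure {X : Type*} [MetricSpace X] (φ : ℝ≥0∞ → ℝ≥0∞) (E : Set X) : ℝ≥0∞ :=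
  ⨅ (t : ℕ → Set X) (_ : E ⊆ ⋃ n, t n), ∑' n, packingPreMeasure φ (t n)

/-- Logarithmic Hausdorff dimension; the infimum of the empty set is `∞`. -/
def logHausdorffDim {X : Type*} [MetricSpace X] [MeasurableSpace X] [BorelSpace X]
    (A : Set X) : ℝ≥0∞ :=
  sInf (ENNReal.ofReal '' {s : ℝ | 0 < s ∧ hausdorffGaugeMeasure (logGauge s) A = 0})

/-- Logarithmic packing dimension; the infimum of the empty set is `∞`. -/
def logPackingDim {X : Type*} [MetricSpace X] (A : Set X) : ℝ≥0∞ :=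
  sInf (ENNReal.ofReal '' {s : ℝ | 0 < s ∧ packingGaugeMeasure (logGauge s) A = 0})

/-- `B` is an `F_σ` set: a countable union of closed sets. -/
def IsFSigma {X : Type*} [TopologicalSpace X] (B : Set X) : Prop :=
  ∃ F : ℕ → Set X, (∀ n, IsClosed (F n)) ∧ B = ⋃ n, F n

/-- `A` is full-measure universal: every set of full Lebesgue measure contains the image of `A`
under some non-singular affine map. -/
def IsFullMeasureUniversal {d : ℕ} (A : Set (EuclideanSpace ℝ (Fin d))) : Prop :=
  ∀ E : Set (EuclideanSpace ℝ (Fin d)), volume Eᶜ = 0 →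
    ∃ f : EuclideanSpace ℝ (Fin d) →ᵃ[ℝ] EuclideanSpace ℝ (Fin d),
      Function.Bijective f ∧ f '' A ⊆ E

end

/-!
For a nonsingular affine map `f`, a point `x` lies in `f(A) + B` exactly when `B` meets the image of
`A` under the nonsingular affine map `y ↦ x - f y`. So it suffices to find an `F_σ` null set `B`
which meets every nonsingular affine image of `A`.

Call a set *log-thin* if the packing numbers at scale `r` are `O(log (1 / r))`. Log-thin sets have
zero Hausdorff measure and zero packing premeasure for the gauge `log⁻ˢ(1 / x)` whenever `s > 1`;
for the packing premeasure one groups the balls according to the dyadic size of `log (1 / r)`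
(`LogThin.packingPreMeasure_eq_zero`). Hence a countable union of log-thin sets has both
logarithmic dimensions at most `1`, and either dimension hypothesis implies that `A` is not such
a union.

If a bounded set `S` is not log-thin, then for every `η > 0` and every bounded family of affine maps
(with bounded inverses) there is a closed set of measure at most `η` which meets `g(S)` for all `g`
in the family, stably under small perturbations of the points of `S`
(`exists_closed_hit_of_not_logThin`). Indeed, choose `r` such that `S` contains `N` points that are
`r`-separated, with `N` much larger than `log (1 / r)`. At scale `r` the family of maps has only
polynomially many members in `1 / r`, so the logarithm of their number is small compared with `N`,
and a small random proportion of the balls of radius comparable to `r` hits all images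
(`exists_hitting_set`).

A bounded part of the Borel set `A` that is not a countable union of log-thin sets is a continuous
image of the Polish space `ℕ → ℕ`. Removing from that space all open sets with small image leaves
a kernel, every relatively open part of which has an image that is not log-thin
(`exists_kernel_of_not_logSigmaThin`). Applying the previous step repeatedly along a finitely
branching tree of open sets that shrink along branches, one finds closed sets `C n` with measures
tending to `0` such that every map of the family sends some point of `A` into `⋂ n, C n`
(`exists_closed_null_hit`). The union of these closed null sets over an exhausting sequence of
bounded families of affine maps is `B`.
-/

/-! ### Separated sets, nets and hitting sets -/

/-- Distinct points of `F` are at distance at least `r`. -/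
def IsSeparatedBy {X : Type*} [MetricSpace X] (r : ℝ) (F : Finset X) : Prop :=
  (F : Set X).Pairwise fun x y => r ≤ dist x y

/-- `S` is *log-thin* if, for small `r`, every `r`-separated subset of `S` has at most
`K * log (1 / r)` points: the packing numbers of `S` grow at most linearly in `log (1 / r)`. -/
def LogThin {X : Type*} [MetricSpace X] (S : Set X) : Prop :=
  ∃ K r₀ : ℝ, 0 < K ∧ 0 < r₀ ∧ ∀ r, 0 < r → r < r₀ → ∀ F : Finset X, (F : Set X) ⊆ S →
    IsSeparatedBy r F → (F.card : ℝ) ≤ K * Real.log (1 / r)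

lemma exists_separated_net {X : Type*} [MetricSpace X] {S : Set X} {r : ℝ} (hr : 0 < r)
    {n : ℕ} (hn : ∀ F : Finset X, (F : Set X) ⊆ S → IsSeparatedBy r F → F.card ≤ n) :
    ∃ F : Finset X, (F : Set X) ⊆ S ∧ IsSeparatedBy r F ∧ ∀ x ∈ S, ∃ y ∈ F, dist x y < r := by
  classical
  let p : ℕ → Prop := fun k => ∃ F : Finset X, (F : Set X) ⊆ S ∧ IsSeparatedBy r F ∧ F.card = k
  have h0 : p 0 := ⟨∅, by simp, by simp [IsSeparatedBy], rfl⟩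
  have hp := Nat.findGreatest_spec (P := p) (Nat.zero_le n) h0
  obtain ⟨F, hFS, hF, hc⟩ := hp
  refine ⟨F, hFS, hF, fun x hx => ?_⟩
  by_contra! hfar
  have hxF : x ∉ F := fun h => by
    have := hfar x h
    rw [dist_self] at this
    linarith
  have hins : p (F.card + 1) := by
    refine ⟨insert x F, ?_, ?_, Finset.card_insert_of_notMem hxF⟩
    · rw [Finset.coe_insert]
      exact insert_subset hx hFS
    · rw [IsSeparatedBy, Finset.coe_insert]
      refine Set.Pairwise.insert hF fun y hy _ => ⟨hfar y hy, ?_⟩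
      rw [dist_comm]
      exact hfar y hy
  have hle : F.card + 1 ≤ n := by
    obtain ⟨F', h1, h2, h3⟩ := hins
    rw [← h3]
    exact hn F' h1 h2
  have := Nat.le_findGreatest hle hins
  omega

/-- In a finite-dimensional normed space, a bounded set has a `ρ`-net of size polynomial in
`1 / ρ`. -/
lemma exists_net_card_le {E : Type*} [NormedAddCommGroup E] [NormedSpace ℝ E]
    [FiniteDimensional ℝ E] {R ρ : ℝ} (hρ : 0 < ρ) (hρR : ρ ≤ R) {S : Set E}
    (hS : S ⊆ Metric.closedBall 0 R) :
    ∃ Q : Finset E, (Q : Set E) ⊆ S ∧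
      (Q.card : ℝ) ≤ (4 * R / ρ) ^ Module.finrank ℝ E ∧ ∀ x ∈ S, ∃ q ∈ Q, dist x q < ρ := by
  have hR : 0 < R := hρ.trans_le hρR
  -- disjoint balls of radius `ρ / 2` about separated points fit into the ball of radius `2 * R`
  have key : ∀ F : Finset E, (F : Set E) ⊆ S → IsSeparatedBy ρ F →
      (F.card : ℝ) ≤ (4 * R / ρ) ^ Module.finrank ℝ E := by
    intro F hFS hF
    borelize E
    let μ : Measure E := Measure.addHaar
    have hdisj : (F : Set E).PairwiseDisjoint fun c => Metric.ball c (ρ / 2) := by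
      intro c hc d hd hcd
      refine Metric.ball_disjoint_ball ?_
      have := hF hc hd hcd
      linarith
    have hsub : ⋃ c ∈ F, Metric.ball c (ρ / 2) ⊆ Metric.ball (0 : E) (2 * R) := by
      refine iUnion₂_subset fun c hc => Metric.ball_subset_ball' ?_
      have := Metric.mem_closedBall.1 (hS (hFS hc))
      linarith
    have hle : (F.card : ℝ≥0∞) * ENNReal.ofReal ((ρ / 2) ^ Module.finrank ℝ E) *
        μ (Metric.ball 0 1) ≤
        ENNReal.ofReal ((2 * R) ^ Module.finrank ℝ E) * μ (Metric.ball 0 1) := by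
      calc _ = μ (⋃ c ∈ F, Metric.ball c (ρ / 2)) := by
            rw [measure_biUnion_finset hdisj fun c _ => measurableSet_ball]
            simp only [μ.addHaar_ball_of_pos _ (half_pos hρ), Finset.sum_const, nsmul_eq_mul,
              mul_assoc]
        _ ≤ μ (Metric.ball (0 : E) (2 * R)) := measure_mono hsub
        _ = _ := μ.addHaar_ball_of_pos _ (by positivity)
    have hle' := (ENNReal.mul_le_mul_iff_left
      (Metric.measure_ball_pos _ _ zero_lt_one).ne' measure_ball_lt_top.ne).1 hle
    have hreal := ENNReal.toReal_le_of_le_ofReal (by positivity) hle'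
    rw [ENNReal.toReal_mul, ENNReal.toReal_natCast, ENNReal.toReal_ofReal (by positivity)]
      at hreal
    have h4 : 4 * R / ρ = 2 * R / (ρ / 2) := by field_simp; norm_num
    rw [h4, div_pow, le_div_iff₀ (by positivity)]
    exact hreal
  obtain ⟨Q, hQS, hQ, hnet⟩ := exists_separated_net hρ
    (n := ⌊(4 * R / ρ) ^ Module.finrank ℝ E⌋₊) fun F h1 h2 => Nat.le_floor (key F h1 h2)
  exact ⟨Q, hQS, key Q hQS hQ, hnet⟩

/-- A family of `m` subsets of `Q`, each with at least `N` points, has a hitting set of size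
about `|Q| * log m / N`: a random choice of that many points works with positive probability. -/
lemma exists_hitting_set {α ι : Type*} [DecidableEq α] (Q : Finset α) (I : Finset ι)
    (T : ι → Finset α) (hT : ∀ i ∈ I, T i ⊆ Q) {N : ℕ} (hN : 0 < N)
    (hcard : ∀ i ∈ I, N ≤ (T i).card) :
    ∃ H : Finset α, (H.card : ℝ) ≤ Q.card * (Real.log I.card + 1) / N ∧
      ∀ i ∈ I, ∃ q ∈ T i, q ∈ H := by
  rcases I.eq_empty_or_nonempty with rfl | hI
  · refine ⟨∅, ?_, by simp⟩
    simp only [Finset.card_empty, Nat.cast_zero, Real.log_zero]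
    positivity
  have hN' : (0 : ℝ) < N := by exact_mod_cast hN
  have hNQ : N ≤ Q.card := by
    obtain ⟨i, hi⟩ := hI
    exact (hcard i hi).trans (Finset.card_le_card (hT i hi))
  have hQ' : (0 : ℝ) < Q.card := by exact_mod_cast hN.trans_le hNQ
  have hm : (0 : ℝ) < I.card := by exact_mod_cast hI.card_pos
  have hlog : 0 ≤ Real.log I.card := Real.log_natCast_nonneg _
  set t : ℕ := ⌊Q.card * Real.log I.card / N⌋₊ + 1 with ht
  -- of the `|Q| ^ t` maps `Fin t → Q`, at most `m * (|Q| - N) ^ t` miss some `T i`; this `t` is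
  -- large enough for that not to account for all of them
  have hchoice : ∃ h ∈ Fintype.piFinset (fun _ : Fin t => Q), ∀ i ∈ I, ∃ k, h k ∈ T i := by
    by_contra! hbad
    have hsub : Fintype.piFinset (fun _ : Fin t => Q) ⊆
        I.biUnion fun i => Fintype.piFinset fun _ : Fin t => Q \ T i := by
      intro h hh
      obtain ⟨i, hi, hk⟩ := hbad h hh
      rw [Finset.mem_biUnion]
      refine ⟨i, hi, Fintype.mem_piFinset.2 fun k => ?_⟩
      exact Finset.mem_sdiff.2 ⟨Fintype.mem_piFinset.1 hh k, hk k⟩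
    have hcount : Q.card ^ t ≤ I.card * (Q.card - N) ^ t := by
      calc Q.card ^ t = (Fintype.piFinset fun _ : Fin t => Q).card := by
            simp [Fintype.card_piFinset]
        _ ≤ ∑ i ∈ I, (Fintype.piFinset fun _ : Fin t => Q \ T i).card :=
            (Finset.card_le_card hsub).trans Finset.card_biUnion_le
        _ ≤ ∑ _i ∈ I, (Q.card - N) ^ t := by
            refine Finset.sum_le_sum fun i hi => ?_
            simp only [Fintype.card_piFinset, Finset.prod_const, Finset.card_univ,
              Fintype.card_fin]
            refine Nat.pow_le_pow_left ?_ t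
            rw [Finset.card_sdiff_of_subset (hT i hi)]
            exact Nat.sub_le_sub_left (hcard i hi) _
        _ = I.card * (Q.card - N) ^ t := by rw [Finset.sum_const, smul_eq_mul]
    have hcount' : (Q.card : ℝ) ^ t ≤ I.card * ((Q.card : ℝ) - N) ^ t := by
      rw [← Nat.cast_sub hNQ]
      exact_mod_cast hcount
    have hexp : (Q.card : ℝ) - N ≤ Q.card * Real.exp (-(N / Q.card)) := by
      have h1 := Real.add_one_le_exp (-((N : ℝ) / Q.card))
      calc (Q.card : ℝ) - N = Q.card * (-((N : ℝ) / Q.card) + 1) := by field_simp; ring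
        _ ≤ _ := by gcongr
    have h0 : (0 : ℝ) ≤ (Q.card : ℝ) - N := by
      rw [← Nat.cast_sub hNQ]; positivity
    have h2 : (Q.card : ℝ) ^ t ≤ I.card * (Q.card ^ t * Real.exp (t * -(N / Q.card))) := by
      calc _ ≤ _ := hcount'
        _ ≤ I.card * (Q.card * Real.exp (-(N / Q.card))) ^ t := by gcongr
        _ = _ := by rw [mul_pow, ← Real.exp_nat_mul]
    have h3 : 1 ≤ I.card * Real.exp (t * -((N : ℝ) / Q.card)) := by
      have hp : (0 : ℝ) < (Q.card : ℝ) ^ t := by positivity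
      refine le_of_mul_le_mul_left ?_ hp
      linarith
    have h4 : (t : ℝ) * (N / Q.card) ≤ Real.log I.card := by
      have h5 := Real.log_le_log one_pos h3
      rw [Real.log_one, Real.log_mul hm.ne' (Real.exp_pos _).ne', Real.log_exp] at h5
      linarith
    have h6 : (t : ℝ) ≤ Q.card * Real.log I.card / N := by
      rw [le_div_iff₀ hN']
      have : (t : ℝ) * N = Q.card * (t * (N / Q.card)) := by field_simp
      rw [this]
      gcongr
    have h7 := Nat.lt_floor_add_one ((Q.card : ℝ) * Real.log I.card / N)
    rw [ht] at h6
    push_cast at h6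
    linarith
  obtain ⟨h, -, hhit⟩ := hchoice
  refine ⟨Finset.univ.image h, ?_, fun i hi => ?_⟩
  · have h1 : ((Finset.univ.image h).card : ℝ) ≤ t := by
      exact_mod_cast Finset.card_image_le.trans (by simp)
    have h2 : (t : ℝ) ≤ Q.card * Real.log I.card / N + 1 := by
      rw [ht]
      push_cast
      gcongr
      exact Nat.floor_le (by positivity)
    have h3 : (1 : ℝ) ≤ Q.card / N := by
      rw [le_div_iff₀ hN', one_mul]
      exact_mod_cast hNQ
    calc _ ≤ (Q.card : ℝ) * Real.log I.card / N + Q.card / N := by linarith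
      _ = _ := by ring
  · obtain ⟨k, hk⟩ := hhit i hi
    exact ⟨h k, hk, Finset.mem_image_of_mem _ (Finset.mem_univ _)⟩

/-! ### A small closed set hit by all affine images -/

/-- The affine maps `x ↦ L x + b`, coded as pairs `(L, b)`, for which `M` bounds `‖L‖`, `‖b‖` and
the norm of the inverse of `L`. -/
def boundedAffine (V : Type*) [NormedAddCommGroup V] [NormedSpace ℝ V] (M : ℝ) :
    Set ((V →L[ℝ] V) × V) :=
  {g | ‖g.1‖ ≤ M ∧ ‖g.2‖ ≤ M ∧ ∀ x, ‖x‖ ≤ M * ‖g.1 x‖}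

/-- For `ρ` proportional to `r`, `boundedAffine V M` has a `ρ`-net of size polynomial in `1 / r`,
and each of its members sends an `r`-separated set of `N` points close to `N` distinct points of a
`ρ`-net of a ball. If `N` is large compared with `log (1 / r)`, a small proportion of the points of
the latter net hits all these images. -/
lemma exists_closed_hit_of_not_logThin {V : Type*} [NormedAddCommGroup V] [NormedSpace ℝ V]
    [FiniteDimensional ℝ V] [MeasurableSpace V] [BorelSpace V] (μ : Measure V)
    [μ.IsAddHaarMeasure] {S : Set V} {R : ℝ} (hR : 1 ≤ R) (hSR : S ⊆ Metric.closedBall 0 R)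
    (hS : ¬ LogThin S) {M : ℝ} (hM : 1 ≤ M) {η : ℝ≥0∞} (hη : η ≠ 0) :
    ∃ (F : Finset V) (δ : ℝ) (C : Set V), (F : Set V) ⊆ S ∧ 0 < δ ∧ IsClosed C ∧ μ C ≤ η ∧
      ∀ g ∈ boundedAffine V M, ∃ a ∈ F, ∀ x ∈ Metric.closedBall a δ, g.1 x + g.2 ∈ C := by
  classical
  set D := Module.finrank ℝ V
  set D' := Module.finrank ℝ ((V →L[ℝ] V) × V)
  set R' := M * (R + 1) with hR'
  have hM0 : 0 < M := by linarith
  have hR0 : 0 < R := by linarith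
  have hR'M : M ≤ R' := by rw [hR']; nlinarith
  set c : ℝ := (4 * R' * (R + 3)) ^ D * (2 * D' + 1) with hc
  have hc0 : 0 < c := by positivity
  -- `c / K` times the measure of the unit ball will bound the measure of `C`
  obtain ⟨K, hK0, hK⟩ : ∃ K : ℝ, 0 < K ∧ ENNReal.ofReal (c / K) * μ (Metric.ball 0 1) ≤ η := by
    have hlim : Filter.Tendsto (fun K : ℝ => ENNReal.ofReal (c / K) * μ (Metric.ball 0 1))
        Filter.atTop (nhds 0) := by
      have h1 : Filter.Tendsto (fun K : ℝ => c / K) Filter.atTop (nhds 0) :=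
        Filter.tendsto_id.const_div_atTop c
      have h2 := ENNReal.Tendsto.mul_const (ENNReal.tendsto_ofReal h1)
        (Or.inr (measure_ball_lt_top (μ := μ) (x := (0 : V)) (r := 1)).ne)
      simpa using h2
    obtain ⟨K, hK0, hK⟩ := ((Filter.eventually_gt_atTop (0 : ℝ)).and
      (hlim.eventually_lt_const (pos_iff_ne_zero.2 hη))).exists
    exact ⟨K, hK0, hK.le⟩
  rw [LogThin] at hS
  push Not at hS
  obtain ⟨r, hr0, hr, F, hFS, hF, hFcard⟩ := hS K (min (Real.exp (-1)) (1 / (12 * M * M))) hK0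
    (by positivity)
  have hr1 : r < Real.exp (-1) := hr.trans_le (min_le_left _ _)
  have hr2 : r < 1 / (12 * M * M) := hr.trans_le (min_le_right _ _)
  have hlog1 : 1 ≤ Real.log (1 / r) := by
    rw [one_div, Real.log_inv]
    have := Real.log_lt_log hr0 hr1
    rw [Real.log_exp] at this
    linarith
  have hN0 : (0 : ℝ) < F.card := lt_trans (by positivity) hFcard
  have hN : 0 < F.card := by exact_mod_cast hN0
  -- `r`-separated points have images that are `r / M = 3 * ρ` apart, so no point of a net is within
  -- `ρ` of two of these images
  set ρ := r / (3 * M) with hρ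
  have hρ0 : 0 < ρ := by positivity
  have hρr : 3 * M * ρ = r := by rw [hρ]; field_simp
  have hρ1 : ρ ≤ 1 := by
    have : r < 1 := hr1.trans (by rw [Real.exp_lt_one_iff]; norm_num)
    nlinarith
  have hρM : ρ ≤ M := hρ1.trans hM
  obtain ⟨Q, -, hQcard, hQnet⟩ := exists_net_card_le (E := V) hρ0 (hρM.trans hR'M)
    (Subset.refl (Metric.closedBall (0 : V) R'))
  obtain ⟨𝒢, h𝒢sub, h𝒢card, h𝒢net⟩ := exists_net_card_le (E := (V →L[ℝ] V) × V) hρ0 hρM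
    (S := boundedAffine V M) (fun g hg => by
      rw [mem_closedBall_zero_iff]
      exact max_le hg.1 hg.2.1)
  let T : (V →L[ℝ] V) × V → Finset V := fun g =>
    Q.filter fun q => ∃ a ∈ F, dist (g.1 a + g.2) q < ρ
  have hnear : ∀ g ∈ 𝒢, ∀ a ∈ F, ∃ q ∈ Q, dist (g.1 a + g.2) q < ρ := by
    intro g hg a ha
    obtain ⟨h1, h2, -⟩ := h𝒢sub hg
    refine hQnet _ ?_
    rw [mem_closedBall_zero_iff]
    have ha' : ‖a‖ ≤ R := mem_closedBall_zero_iff.1 (hSR (hFS ha))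
    calc ‖g.1 a + g.2‖ ≤ ‖g.1‖ * ‖a‖ + ‖g.2‖ :=
          (norm_add_le _ _).trans (by gcongr; exact g.1.le_opNorm a)
      _ ≤ M * R + M := by gcongr
      _ = R' := by rw [hR']; ring
  have hTcard : ∀ g ∈ 𝒢, F.card ≤ (T g).card := by
    intro g hg
    choose! q hqQ hq using hnear g hg
    refine Finset.card_le_card_of_injOn q (fun a ha => Finset.mem_coe.2 <|
      Finset.mem_filter.2 ⟨hqQ a ha, a, ha, hq a ha⟩) ?_
    intro a ha b hb hab
    by_contra hne
    have h1 : r ≤ dist a b := hF ha hb hne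
    have h2 := (h𝒢sub hg).2.2 (a - b)
    have h3 : ‖g.1 (a - b)‖ < 2 * ρ := by
      have e : g.1 (a - b) = (g.1 a + g.2) - (g.1 b + g.2) := by rw [map_sub]; abel
      rw [e, ← dist_eq_norm]
      have h4 := hq b hb
      rw [← hab, dist_comm] at h4
      linarith [dist_triangle (g.1 a + g.2) (q a) (g.1 b + g.2), hq a ha]
    rw [dist_eq_norm] at h1
    nlinarith
  obtain ⟨H, hHcard, hHhit⟩ := exists_hitting_set Q 𝒢 T
    (fun g _ => Finset.filter_subset _ _) hN hTcard
  refine ⟨F, ρ / M, ⋃ q ∈ H, Metric.closedBall q ((R + 3) * ρ), hFS, by positivity,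
    H.finite_toSet.isClosed_biUnion fun q _ => Metric.isClosed_closedBall, ?_, ?_⟩
  · have hlogm : Real.log 𝒢.card ≤ 2 * D' * Real.log (1 / r) := by
      rcases Nat.eq_zero_or_pos 𝒢.card with h0 | h0
      · rw [h0, Nat.cast_zero, Real.log_zero]
        positivity
      · have h1 : Real.log (4 * M / ρ) ≤ 2 * Real.log (1 / r) := by
          have h2 : 4 * M / ρ = (12 * M * M) * (1 / r) := by rw [hρ]; field_simp; ring
          rw [h2, Real.log_mul (by positivity) (by positivity), two_mul]
          gcongr
          rw [lt_one_div hr0 (by positivity)] at hr2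
          exact hr2.le
        calc Real.log 𝒢.card ≤ Real.log ((4 * M / ρ) ^ D') :=
              Real.log_le_log (by exact_mod_cast h0) h𝒢card
          _ = D' * Real.log (4 * M / ρ) := Real.log_pow _ _
          _ ≤ D' * (2 * Real.log (1 / r)) := by gcongr
          _ = _ := by ring
    have hreal : H.card * ((R + 3) * ρ) ^ D ≤ c / K := by
      calc H.card * ((R + 3) * ρ) ^ D
          ≤ (Q.card * (Real.log 𝒢.card + 1) / F.card) * ((R + 3) * ρ) ^ D := by gcongr
        _ ≤ ((4 * R' / ρ) ^ D * (2 * D' * Real.log (1 / r) + Real.log (1 / r)) /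
              (K * Real.log (1 / r))) * ((R + 3) * ρ) ^ D := by
            gcongr
        _ = c / K := by
            have hl : Real.log (1 / r) ≠ 0 := by positivity
            rw [hc, div_pow, mul_pow (R + 3), mul_pow (4 * R')]
            field_simp
    calc μ (⋃ q ∈ H, Metric.closedBall q ((R + 3) * ρ))
        ≤ ∑ q ∈ H, μ (Metric.closedBall q ((R + 3) * ρ)) := measure_biUnion_finset_le _ _
      _ = ENNReal.ofReal (H.card * ((R + 3) * ρ) ^ D) * μ (Metric.ball 0 1) := by
          simp only [μ.addHaar_closedBall _ (by positivity : (0 : ℝ) ≤ (R + 3) * ρ),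
            Finset.sum_const, nsmul_eq_mul]
          rw [ENNReal.ofReal_mul (by positivity), ENNReal.ofReal_natCast, mul_assoc]
      _ ≤ ENNReal.ofReal (c / K) * μ (Metric.ball 0 1) := by gcongr
      _ ≤ η := hK
  · intro g hg
    obtain ⟨g', hg', hgg'⟩ := h𝒢net g hg
    obtain ⟨q, hqT, hqH⟩ := hHhit g' hg'
    obtain ⟨-, a, ha, haq⟩ := Finset.mem_filter.1 hqT
    refine ⟨a, ha, fun x hx => mem_iUnion₂.2 ⟨q, hqH, ?_⟩⟩
    have ha' : ‖a‖ ≤ R := mem_closedBall_zero_iff.1 (hSR (hFS ha))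
    rw [Metric.mem_closedBall, dist_eq_norm] at hx ⊢
    rw [dist_eq_norm] at haq hgg'
    have hd1 : ‖g.1 - g'.1‖ ≤ ρ := (norm_fst_le (g - g')).trans hgg'.le
    have hd2 : ‖g.2 - g'.2‖ ≤ ρ := (norm_snd_le (g - g')).trans hgg'.le
    -- pass from `g x` to `g a`, then to `g' a`, then to `q`
    have e : g.1 x + g.2 - q = g.1 (x - a) + ((g.1 - g'.1) a + (g.2 - g'.2)) +
        (g'.1 a + g'.2 - q) := by
      simp only [map_sub, sub_apply]; abel
    have h1 : ‖g.1 (x - a)‖ ≤ ρ := by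
      calc ‖g.1 (x - a)‖ ≤ ‖g.1‖ * ‖x - a‖ := g.1.le_opNorm _
        _ ≤ M * (ρ / M) := by gcongr; exact hg.1
        _ = ρ := by field_simp
    have h2 : ‖(g.1 - g'.1) a‖ ≤ ρ * R := ((g.1 - g'.1).le_opNorm a).trans (by gcongr)
    rw [e]
    have h3 := norm_add₃_le (a := g.1 (x - a)) (b := (g.1 - g'.1) a + (g.2 - g'.2))
      (c := g'.1 a + g'.2 - q)
    have h4 := norm_add_le ((g.1 - g'.1) a) (g.2 - g'.2)
    linarith

/-! ### A closed null set hit by all affine images in a bounded family -/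

/-- One step of the tree construction: each open set of the finite family `𝒱` is refined by small
open sets, so that every map in `boundedAffine V M` sends one of the refining sets into `C`. -/
lemma exists_refinement {V : Type*} [NormedAddCommGroup V] [NormedSpace ℝ V]
    [FiniteDimensional ℝ V] [MeasurableSpace V] [BorelSpace V] (μ : Measure V)
    [μ.IsAddHaarMeasure] {X : Type*} [MetricSpace X] {f : X → V} (hf : Continuous f) {R : ℝ}
    (hR : 1 ≤ R) (hfR : ∀ x, f x ∈ Metric.closedBall 0 R) {K : Set X}
    (hK : ∀ U, IsOpen U → (U ∩ K).Nonempty → ¬ LogThin (f '' (U ∩ K))) {M : ℝ} (hM : 1 ≤ M)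
    (𝒱 : Finset (Set X)) (h𝒱 : ∀ U ∈ 𝒱, IsOpen U ∧ (U ∩ K).Nonempty) {ε : ℝ} (hε : 0 < ε)
    {η : ℝ≥0∞} (hη : η ≠ 0) :
    ∃ (𝒲 : Finset (Set X)) (C : Set V), (∀ W ∈ 𝒲, IsOpen W ∧ (W ∩ K).Nonempty) ∧ IsClosed C ∧
      μ C ≤ η ∧ ∀ g ∈ boundedAffine V M, ∀ U ∈ 𝒱, ∃ W ∈ 𝒲, closure W ⊆ U ∧
        (∀ x ∈ W, ∀ y ∈ W, dist x y ≤ ε) ∧ ∀ x ∈ W, g.1 (f x) + g.2 ∈ C := by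
  classical
  have hη' : η / (𝒱.card + 1) ≠ 0 := ENNReal.div_ne_zero.2 ⟨hη, by finiteness⟩
  have h1 : ∀ U ∈ 𝒱, ∃ (𝒲 : Finset (Set X)) (C : Set V),
      (∀ W ∈ 𝒲, IsOpen W ∧ (W ∩ K).Nonempty) ∧ IsClosed C ∧
      μ C ≤ η / (𝒱.card + 1) ∧ ∀ g ∈ boundedAffine V M, ∃ W ∈ 𝒲, closure W ⊆ U ∧
        (∀ x ∈ W, ∀ y ∈ W, dist x y ≤ ε) ∧ ∀ x ∈ W, g.1 (f x) + g.2 ∈ C := by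
    intro U hU
    obtain ⟨hUo, hUK⟩ := h𝒱 U hU
    obtain ⟨F, δ, C, hFS, hδ, hC, hμC, hhit⟩ := exists_closed_hit_of_not_logThin μ hR
      (by rintro _ ⟨x, -, rfl⟩; exact hfR x) (hK U hUo hUK) hM hη'
    have h2 : ∀ a ∈ F, ∃ W : Set X, (IsOpen W ∧ (W ∩ K).Nonempty) ∧ closure W ⊆ U ∧
        (∀ x ∈ W, ∀ y ∈ W, dist x y ≤ ε) ∧ ∀ x ∈ W, f x ∈ Metric.closedBall a δ := by
      intro a ha
      obtain ⟨x, ⟨hxU, hxK⟩, rfl⟩ := hFS ha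
      have hnhds : U ∩ f ⁻¹' Metric.closedBall (f x) δ ∈ nhds x :=
        Filter.inter_mem (hUo.mem_nhds hxU)
          (hf.continuousAt.preimage_mem_nhds (Metric.closedBall_mem_nhds _ hδ))
      obtain ⟨e, he, hsub⟩ := Metric.nhds_basis_closedBall.mem_iff.1 hnhds
      have hmin : 0 < min e (ε / 2) := lt_min he (half_pos hε)
      refine ⟨Metric.ball x (min e (ε / 2)), ⟨Metric.isOpen_ball, x,
        Metric.mem_ball_self hmin, hxK⟩, ?_, ?_, ?_⟩
      · exact Metric.closure_ball_subset_closedBall.trans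
          ((Metric.closedBall_subset_closedBall (min_le_left _ _)).trans
            (hsub.trans inter_subset_left))
      · intro y hy z hz
        have h3 := (Metric.mem_ball.1 hy).trans_le (min_le_right _ _)
        have h4 := (Metric.mem_ball.1 hz).trans_le (min_le_right _ _)
        linarith [dist_triangle_right y z x]
      · intro y hy
        exact (hsub (Metric.ball_subset_closedBall
          (Metric.ball_subset_ball (min_le_left _ _) hy))).2
    choose! W hW1 hW2 hW3 hW4 using h2
    refine ⟨F.image W, C, ?_, hC, hμC, fun g hg => ?_⟩
    · intro W' hW'
      obtain ⟨a, ha, rfl⟩ := Finset.mem_image.1 hW'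
      exact hW1 a ha
    · obtain ⟨a, ha, hag⟩ := hhit g hg
      exact ⟨W a, Finset.mem_image_of_mem _ ha, hW2 a ha, hW3 a ha,
        fun x hx => hag _ (hW4 a ha x hx)⟩
  choose! 𝒲 C h𝒲 hC hμC hhit using h1
  refine ⟨𝒱.biUnion 𝒲, ⋃ U ∈ 𝒱, C U, ?_, 𝒱.finite_toSet.isClosed_biUnion hC, ?_, ?_⟩
  · intro W hW
    obtain ⟨U, hU, hWU⟩ := Finset.mem_biUnion.1 hW
    exact h𝒲 U hU W hWU
  · calc μ (⋃ U ∈ 𝒱, C U) ≤ ∑ U ∈ 𝒱, μ (C U) := measure_biUnion_finset_le _ _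
      _ ≤ ∑ _U ∈ 𝒱, η / (𝒱.card + 1) := Finset.sum_le_sum hμC
      _ = 𝒱.card * (η / (𝒱.card + 1)) := by rw [Finset.sum_const, nsmul_eq_mul]
      _ ≤ (𝒱.card + 1) * (η / (𝒱.card + 1)) := by gcongr; exact le_self_add
      _ ≤ η := ENNReal.mul_div_le
  · intro g hg U hU
    obtain ⟨W, hW, h2, h3, h4⟩ := hhit U hU g hg
    exact ⟨W, Finset.mem_biUnion.2 ⟨U, hU, hW⟩, h2, h3,
      fun x hx => mem_iUnion₂.2 ⟨U, hU, h4 x hx⟩⟩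

/-- If no nonempty relatively open part of `K` has a log-thin image under `f`, then some closed
null set meets the image of the range of `f` under every map in `boundedAffine V M`. Iterating
`exists_refinement` gives sets `C n`; for fixed `g`, a branch of the tree of refinements shrinks to
a point which `g ∘ f` sends into every `C n`. -/
lemma exists_closed_null_hit {V : Type*} [NormedAddCommGroup V] [NormedSpace ℝ V]
    [FiniteDimensional ℝ V] [MeasurableSpace V] [BorelSpace V] (μ : Measure V)
    [μ.IsAddHaarMeasure] {X : Type*} [MetricSpace X] [CompleteSpace X] {f : X → V}
    (hf : Continuous f) {R : ℝ} (hR : 1 ≤ R) (hfR : ∀ x, f x ∈ Metric.closedBall 0 R) {K : Set X}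
    (hKne : K.Nonempty)
    (hK : ∀ U, IsOpen U → (U ∩ K).Nonempty → ¬ LogThin (f '' (U ∩ K))) {M : ℝ} (hM : 1 ≤ M) :
    ∃ C : Set V, IsClosed C ∧ μ C = 0 ∧
      ∀ g ∈ boundedAffine V M, ∃ x, g.1 (f x) + g.2 ∈ C := by
  let Family := {𝒱 : Finset (Set X) // ∀ U ∈ 𝒱, IsOpen U ∧ (U ∩ K).Nonempty}
  have hstep : ∀ (n : ℕ) (𝒱 : Family), ∃ (𝒲 : Family) (C : Set V), IsClosed C ∧
      μ C ≤ (n : ℝ≥0∞)⁻¹ ∧ ∀ g ∈ boundedAffine V M, ∀ U ∈ 𝒱.1, ∃ W ∈ 𝒲.1, closure W ⊆ U ∧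
        (∀ x ∈ W, ∀ y ∈ W, dist x y ≤ 1 / ((n : ℝ) + 1)) ∧ ∀ x ∈ W, g.1 (f x) + g.2 ∈ C := by
    intro n 𝒱
    obtain ⟨𝒲, C, h1, h2⟩ := exists_refinement μ hf hR hfR hK hM 𝒱.1 𝒱.2
      (Nat.one_div_pos_of_nat (n := n)) (ENNReal.inv_ne_zero.2 (ENNReal.natCast_ne_top n))
    exact ⟨⟨𝒲, h1⟩, C, h2⟩
  -- for `n = 0` the bound `μ C ≤ (n : ℝ≥0∞)⁻¹` is void; only the limit matters
  choose next C hC hμC hhit using hstep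
  let root : Family := ⟨{univ}, by simpa using hKne⟩
  let level : ℕ → Family := fun n => Nat.rec root (fun n 𝒱 => next n 𝒱) n
  have hlevel : ∀ n, level (n + 1) = next n (level n) := fun n => rfl
  refine ⟨⋂ n, C n (level n), isClosed_iInter fun n => hC n _, ?_, fun g hg => ?_⟩
  · refine le_antisymm (ge_of_tendsto' ENNReal.tendsto_inv_nat_nhds_zero fun n => ?_) zero_le
    exact (measure_mono (iInter_subset _ n)).trans (hμC n _)
  · -- for fixed `g`, follow a branch of the tree whose sets `g ∘ f` maps into the sets `C n`
    have hchild : ∀ (n : ℕ) (U : {U // U ∈ (level n).1}), ∃ W : {W // W ∈ (level (n + 1)).1},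
        closure W.1 ⊆ U.1 ∧ (∀ x ∈ W.1, ∀ y ∈ W.1, dist x y ≤ 1 / ((n : ℝ) + 1)) ∧
        ∀ x ∈ W.1, g.1 (f x) + g.2 ∈ C n (level n) := by
      intro n U
      obtain ⟨W, hW, h⟩ := hhit n (level n) g hg U.1 U.2
      exact ⟨⟨W, hW⟩, h⟩
    choose child hsub hdiam hmem using hchild
    let branch : (n : ℕ) → {U // U ∈ (level n).1} := fun n =>
      Nat.rec ⟨univ, Finset.mem_singleton_self _⟩ (fun n U => child n U) n
    have hbranch : ∀ n, branch (n + 1) = child n (branch n) := fun n => rfl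
    have hanti : Antitone fun n => (branch n).1 := antitone_nat_of_succ_le fun n => by
      rw [hbranch]
      exact subset_closure.trans (hsub n _)
    have hne : ∀ n, (branch n).1.Nonempty := fun n =>
      ((level n).2 _ (branch n).2).2.mono inter_subset_left
    choose x hx using hne
    have hcauchy : CauchySeq fun n => x (n + 1) := by
      refine cauchySeq_of_le_tendsto_0' (fun n : ℕ => 1 / ((n : ℝ) + 1)) (fun n m hnm => ?_)
        tendsto_one_div_add_atTop_nhds_zero_nat
      have h1 := hx (n + 1)
      have h2 := hanti (Nat.succ_le_succ hnm) (hx (m + 1))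
      exact hdiam n (branch n) _ h1 _ h2
    obtain ⟨y, hy⟩ := cauchySeq_tendsto_of_complete hcauchy
    have hyn : ∀ n, y ∈ (branch n).1 := by
      intro n
      refine hsub n (branch n) (mem_closure_of_tendsto hy ?_)
      filter_upwards [Filter.eventually_ge_atTop n] with m hm
      exact hanti (Nat.succ_le_succ hm) (hx (m + 1))
    exact ⟨y, mem_iInter.2 fun n => hmem n (branch n) y (hyn (n + 1))⟩

/-! ### Countable unions of log-thin sets have small logarithmic dimensions -/

/-- `S` is covered by countably many log-thin sets. -/
def LogSigmaThin {X : Type*} [MetricSpace X] (S : Set X) : Prop :=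
  ∃ 𝒯 : Set (Set X), 𝒯.Countable ∧ (∀ T ∈ 𝒯, LogThin T) ∧ S ⊆ ⋃₀ 𝒯

lemma LogThin.logSigmaThin {X : Type*} [MetricSpace X] {S : Set X} (hS : LogThin S) :
    LogSigmaThin S :=
  ⟨{S}, countable_singleton S, by simpa using hS, by simp⟩

lemma LogSigmaThin.mono {X : Type*} [MetricSpace X] {S T : Set X} (hT : LogSigmaThin T)
    (hST : S ⊆ T) : LogSigmaThin S := by
  obtain ⟨𝒯, h1, h2, h3⟩ := hT
  exact ⟨𝒯, h1, h2, hST.trans h3⟩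

lemma LogSigmaThin.sUnion {X : Type*} [MetricSpace X] {𝒮 : Set (Set X)} (h𝒮 : 𝒮.Countable)
    (h : ∀ S ∈ 𝒮, LogSigmaThin S) : LogSigmaThin (⋃₀ 𝒮) := by
  choose! 𝒯 h1 h2 h3 using h
  refine ⟨⋃ S ∈ 𝒮, 𝒯 S, h𝒮.biUnion h1, ?_, sUnion_subset fun S hS x hx => ?_⟩
  · intro T hT
    obtain ⟨S, hS, hTS⟩ := mem_iUnion₂.1 hT
    exact h2 S hS T hTS
  · obtain ⟨T, hT, hxT⟩ := h3 S hS hx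
    exact ⟨T, mem_biUnion hS hT, hxT⟩

lemma LogSigmaThin.exists_seq {X : Type*} [MetricSpace X] {S : Set X} (hS : LogSigmaThin S) :
    ∃ t : ℕ → Set X, (∀ n, LogThin (t n)) ∧ S ⊆ ⋃ n, t n := by
  obtain ⟨𝒯, h1, h2, h3⟩ := hS
  have hempty : LogThin (∅ : Set X) := by
    refine ⟨1, 1, one_pos, one_pos, fun r h0 hr F hF _ => ?_⟩
    have hF' : F = ∅ := by simpa using hF
    rw [hF', Finset.card_empty, Nat.cast_zero, one_mul]
    exact Real.log_nonneg (one_le_one_div h0 hr.le)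
  obtain ⟨t, ht⟩ := (h1.insert ∅).exists_eq_range (insert_nonempty _ _)
  refine ⟨t, fun n => ?_, ?_⟩
  · have : t n ∈ insert ∅ 𝒯 := ht ▸ mem_range_self n
    rcases this with h | h
    · rwa [h]
    · exact h2 _ h
  · rw [← sUnion_range, ← ht]
    exact h3.trans (sUnion_subset_sUnion (subset_insert _ _))

lemma logGauge_le {s t : ℝ} (hs : 0 ≤ s) (ht : 1 ≤ t) {x : ℝ≥0∞}
    (hx : x ≤ ENNReal.ofReal (Real.exp (-t))) : logGauge s x ≤ ENNReal.ofReal (t ^ (-s)) := by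
  rw [logGauge]
  split_ifs with h0
  · exact zero_le
  refine ENNReal.ofReal_le_ofReal (Real.rpow_le_rpow_of_nonpos (by linarith) ?_ (by linarith))
  refine le_max_of_le_right ?_
  have hxt : x ≠ ⊤ := (hx.trans_lt ENNReal.ofReal_lt_top).ne
  have hpos : 0 < x.toReal := ENNReal.toReal_pos h0 hxt
  have h1 : x.toReal ≤ Real.exp (-t) := ENNReal.toReal_le_of_le_ofReal (Real.exp_pos _).le hx
  have h2 := Real.log_le_log hpos h1
  rw [Real.log_exp] at h2
  rw [one_div, Real.log_inv]
  linarith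

/-- Cover a log-thin set by balls of radius `exp (-n) / 2`: about `n` of them suffice, and the
gauge of each is at most `n ^ (-s)`. -/
lemma LogThin.hausdorffGaugeMeasure_eq_zero {X : Type*} [MetricSpace X] [MeasurableSpace X]
    [BorelSpace X] {S : Set X} (hS : LogThin S) {s : ℝ} (hs : 1 < s) :
    hausdorffGaugeMeasure (logGauge s) S = 0 := by
  obtain ⟨K, r₀, hK, hr₀, h⟩ := hS
  have hexp : Filter.Tendsto (fun n : ℕ => Real.exp (-(n : ℝ))) Filter.atTop (nhds 0) :=
    Real.tendsto_exp_neg_atTop_nhds_zero.comp tendsto_natCast_atTop_atTop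
  obtain ⟨n₀, hn₀⟩ := Filter.eventually_atTop.1
    ((hexp.eventually_lt_const hr₀).and (Filter.eventually_ge_atTop 1))
  have hlog : ∀ n : ℕ, Real.log (1 / (Real.exp (-(n : ℝ)) / 2)) = n + Real.log 2 := by
    intro n
    rw [one_div_div, Real.log_div two_ne_zero (Real.exp_pos _).ne', Real.log_exp]
    ring
  have hnet : ∀ n : ℕ, ∃ F : Finset X, n₀ ≤ n →
      (F.card : ℝ) ≤ K * (n + Real.log 2) ∧
      ∀ x ∈ S, ∃ y ∈ F, dist x y < Real.exp (-(n : ℝ)) / 2 := by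
    intro n
    by_cases hn : n₀ ≤ n
    · have hr : 0 < Real.exp (-(n : ℝ)) / 2 := by positivity
      have hcard := h _ hr ((half_lt_self (Real.exp_pos _)).trans (hn₀ n hn).1)
      rw [hlog n] at hcard
      obtain ⟨F, hFS, hF, hcov⟩ := exists_separated_net hr
        (n := ⌊K * (n + Real.log 2)⌋₊) fun F h1 h2 => Nat.le_floor (hcard F h1 h2)
      exact ⟨F, fun _ => ⟨hcard F hFS hF, hcov⟩⟩
    · exact ⟨∅, fun hn' => absurd hn' hn⟩
  choose F hF using hnet
  have hdiam : ∀ (n : ℕ) (y : X), Metric.ediam (Metric.closedBall y (Real.exp (-(n : ℝ)) / 2)) ≤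
      ENNReal.ofReal (Real.exp (-(n : ℝ))) := by
    intro n y
    refine Metric.ediam_le fun a ha b hb => ?_
    rw [edist_dist]
    refine ENNReal.ofReal_le_ofReal ?_
    linarith [dist_triangle_right a b y, Metric.mem_closedBall.1 ha, Metric.mem_closedBall.1 hb]
  have hle := Measure.mkMetric_le_liminf_sum (l := Filter.atTop) S
    (fun n : ℕ => ENNReal.ofReal (Real.exp (-(n : ℝ))))
    (by simpa using ENNReal.tendsto_ofReal hexp)
    (fun n (y : F n) => Metric.closedBall (y : X) (Real.exp (-(n : ℝ)) / 2))
    (Filter.Eventually.of_forall fun n y => hdiam n y)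
    (by
      filter_upwards [Filter.eventually_ge_atTop n₀] with n hn x hx
      obtain ⟨y, hy, hxy⟩ := (hF n hn).2 x hx
      exact mem_iUnion.2 ⟨⟨y, hy⟩, hxy.le⟩) (logGauge s)
  have hlim : Filter.Tendsto (fun n : ℕ => ENNReal.ofReal (2 * K * (n : ℝ) ^ (-(s - 1))))
      Filter.atTop (nhds 0) := by
    have h1 := ((tendsto_rpow_neg_atTop (sub_pos.2 hs)).comp
      (tendsto_natCast_atTop_atTop (R := ℝ))).const_mul (2 * K)
    simpa using ENNReal.tendsto_ofReal h1
  have hsum : Filter.Tendsto (fun n : ℕ => ∑ y : F n,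
      logGauge s (Metric.ediam (Metric.closedBall (y : X) (Real.exp (-(n : ℝ)) / 2))))
      Filter.atTop (nhds 0) := by
    refine tendsto_of_tendsto_of_tendsto_of_le_of_le' tendsto_const_nhds hlim
      (Filter.Eventually.of_forall fun _ => zero_le) ?_
    filter_upwards [Filter.eventually_ge_atTop n₀] with n hn
    have hn1 : (1 : ℝ) ≤ n := by exact_mod_cast (hn₀ n hn).2
    calc _ ≤ ∑ _y : F n, ENNReal.ofReal ((n : ℝ) ^ (-s)) :=
          Finset.sum_le_sum fun y _ => logGauge_le (by linarith) hn1 (hdiam n y)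
      _ = ENNReal.ofReal ((F n).card * (n : ℝ) ^ (-s)) := by
          rw [Finset.sum_const, nsmul_eq_mul, ENNReal.ofReal_mul (by positivity),
            ENNReal.ofReal_natCast]
          simp
      _ ≤ ENNReal.ofReal (2 * K * (n : ℝ) ^ (-(s - 1))) := by
          refine ENNReal.ofReal_le_ofReal ?_
          have e : (n : ℝ) ^ (-(s - 1)) = n * (n : ℝ) ^ (-s) := by
            rw [show -(s - 1) = 1 + -s by ring, Real.rpow_add (by linarith), Real.rpow_one]
          have h2 : ((F n).card : ℝ) ≤ 2 * K * n := by
            have := (hF n hn).1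
            have := Real.log_two_lt_d9
            nlinarith
          rw [e, ← mul_assoc]
          gcongr
  rw [hsum.liminf_eq] at hle
  exact le_antisymm hle zero_le

/-- In a packing of a log-thin set, the balls with `2 ^ j ≤ log (1 / r) < 2 ^ (j + 1)` have
`exp (-2 ^ (j + 1))`-separated centres, so there are at most about `2 ^ j` of them, each of gauge
at most `2 ^ (-j * s)`. For `s > 1` the sum over `j` is the tail of a geometric series. -/
lemma LogThin.packingPreMeasure_eq_zero {X : Type*} [MetricSpace X] {S : Set X} (hS : LogThin S)
    {s : ℝ} (hs : 1 < s) : packingPreMeasure (logGauge s) S = 0 := by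
  classical
  obtain ⟨K, r₀, hK, hr₀, h⟩ := hS
  set q : ℝ≥0∞ := ENNReal.ofReal ((2 : ℝ) ^ (1 - s)) with hq
  have hq1 : q < 1 := by
    rw [hq, ENNReal.ofReal_lt_one]
    exact Real.rpow_lt_one_of_one_lt_of_neg one_lt_two (by linarith)
  have hbound : ∀ J : ℕ, Real.exp (-2 ^ J) < r₀ →
      packingPreMeasure (logGauge s) S ≤ ENNReal.ofReal (2 * K) * (1 - q)⁻¹ * q ^ J := by
    intro J hJ
    rw [packingPreMeasure]
    refine iInf₂_le_of_le (Real.exp (-2 ^ J)).toNNReal (by simp [Real.exp_pos]) ?_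
    refine iSup₂_le fun P hP => ?_
    have hrad : ∀ p : P, (0 : ℝ) < p.1.2 ∧ (p.1.2 : ℝ) < Real.exp (-2 ^ J) := by
      intro p
      obtain ⟨-, h1, h2⟩ := hP.1 p.1 p.2
      exact ⟨by exact_mod_cast h1, Real.lt_toNNReal_iff_coe_lt.1 h2⟩
    have hblock : ∀ p : P, ∃ k : ℕ, (2 : ℝ) ^ (J + k) ≤ Real.log (1 / p.1.2) ∧
        Real.log (1 / p.1.2) < 2 ^ (J + k + 1) := by
      intro p
      obtain ⟨h1, h2⟩ := hrad p
      have h3 : (2 : ℝ) ^ J < Real.log (1 / p.1.2) := by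
        have := Real.log_lt_log h1 h2
        rw [Real.log_exp] at this
        rw [one_div, Real.log_inv]
        linarith
      obtain ⟨n, hn1, hn2⟩ := exists_nat_pow_near
        ((one_le_pow₀ (one_le_two (α := ℝ))).trans h3.le) (one_lt_two (α := ℝ))
      have hJn : J < n + 1 := (pow_lt_pow_iff_right₀ (one_lt_two (α := ℝ))).1 (h3.trans hn2)
      obtain ⟨k, rfl⟩ := Nat.exists_eq_add_of_le (Nat.lt_succ_iff.1 hJn)
      exact ⟨k, hn1, hn2⟩
    choose k hk1 hk2 using hblock
    have hfiber : ∀ j : ℕ, ∑' p : k ⁻¹' {j}, logGauge s (p.1.1.2 : ℝ≥0∞) ≤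
        ENNReal.ofReal (2 * K) * q ^ J * q ^ j := by
      intro j
      rw [ENNReal.tsum_eq_iSup_sum]
      refine iSup_le fun G => ?_
      have hr1 : ∀ p : k ⁻¹' {j}, Real.exp (-2 ^ (J + j + 1)) < p.1.1.2 ∧
          (p.1.1.2 : ℝ) ≤ Real.exp (-2 ^ (J + j)) := by
        rintro ⟨p, rfl⟩
        have h0 := (hrad p).1
        have h1 := hk1 p
        have h2 := hk2 p
        rw [one_div, Real.log_inv] at h1 h2
        rw [← Real.lt_log_iff_exp_lt h0, ← Real.log_le_iff_le_exp h0]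
        exact ⟨by linarith, by linarith⟩
      have hdist : ∀ p ∈ G, ∀ p' ∈ G, p ≠ p' →
          Real.exp (-2 ^ (J + j + 1)) ≤ dist p.1.1.1 p'.1.1.1 := by
        intro p _ p' _ hne
        by_contra! hlt
        have hne' : p.1.1 ≠ p'.1.1 := fun e => hne (Subtype.ext (Subtype.ext e))
        exact Set.disjoint_left.1 (hP.2 p.1.2 p'.1.2 hne')
          (Metric.mem_closedBall_self p.1.1.2.coe_nonneg) (hlt.trans (hr1 p').1).le
      have hinj : Set.InjOn (fun p : k ⁻¹' {j} => p.1.1.1) G := by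
        intro p hp p' hp' e
        by_contra hne
        have h1 := hdist p hp p' hp' hne
        have e' : p.1.1.1 = p'.1.1.1 := e
        rw [e', dist_self] at h1
        exact absurd h1 (not_le.2 (Real.exp_pos _))
      have hcard : (G.card : ℝ) ≤ K * 2 ^ (J + j + 1) := by
        rw [← Finset.card_image_of_injOn hinj]
        have hlt : Real.exp (-2 ^ (J + j + 1)) < r₀ := by
          refine lt_of_le_of_lt (Real.exp_le_exp.2 (neg_le_neg ?_)) hJ
          exact pow_le_pow_right₀ one_le_two (by omega)
        have h1 := h _ (Real.exp_pos _) hlt (G.image fun p => p.1.1.1) ?_ ?_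
        · rwa [one_div, ← Real.exp_neg, neg_neg, Real.log_exp] at h1
        · intro x hx
          obtain ⟨p, -, rfl⟩ := Finset.mem_image.1 hx
          exact (hP.1 _ p.1.2).1
        · intro x hx y hy hxy
          obtain ⟨p, hp, rfl⟩ := Finset.mem_image.1 hx
          obtain ⟨p', hp', rfl⟩ := Finset.mem_image.1 hy
          exact hdist p hp p' hp' fun e => hxy (by rw [e])
      calc ∑ p ∈ G, logGauge s (p.1.1.2 : ℝ≥0∞)
          ≤ ∑ _p ∈ G, ENNReal.ofReal (((2 : ℝ) ^ (J + j)) ^ (-s)) := by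
            refine Finset.sum_le_sum fun p _ => logGauge_le (by linarith)
              (one_le_pow₀ one_le_two) ?_
            rw [← ENNReal.ofReal_coe_nnreal]
            exact ENNReal.ofReal_le_ofReal (hr1 p).2
        _ = ENNReal.ofReal (G.card * ((2 : ℝ) ^ (J + j)) ^ (-s)) := by
            rw [Finset.sum_const, nsmul_eq_mul, ENNReal.ofReal_mul (by positivity),
              ENNReal.ofReal_natCast]
        _ ≤ ENNReal.ofReal (K * 2 ^ (J + j + 1) * ((2 : ℝ) ^ (J + j)) ^ (-s)) := by gcongr
        _ = ENNReal.ofReal (2 * K * ((2 : ℝ) ^ (1 - s)) ^ (J + j)) := by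
            congr 1
            have e : ((2 : ℝ) ^ (1 - s)) ^ (J + j) = 2 ^ (J + j) * ((2 : ℝ) ^ (J + j)) ^ (-s) := by
              rw [← Real.rpow_natCast, ← Real.rpow_mul zero_le_two, mul_comm (1 - s),
                Real.rpow_mul zero_le_two, Real.rpow_natCast, sub_eq_add_neg,
                Real.rpow_add (by positivity), Real.rpow_one]
            rw [e, pow_succ]
            ring
        _ = ENNReal.ofReal (2 * K) * q ^ J * q ^ j := by
            rw [ENNReal.ofReal_mul (by positivity), ENNReal.ofReal_pow (by positivity), pow_add,
              mul_assoc]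
    calc ∑' p : P, logGauge s (p.1.2 : ℝ≥0∞)
        = ∑' j, ∑' p : k ⁻¹' {j}, logGauge s (p.1.1.2 : ℝ≥0∞) :=
          (ENNReal.tsum_fiberwise (fun p : P => logGauge s (p.1.2 : ℝ≥0∞)) k).symm
      _ ≤ ∑' j, ENNReal.ofReal (2 * K) * q ^ J * q ^ j := ENNReal.tsum_le_tsum hfiber
      _ = ENNReal.ofReal (2 * K) * (1 - q)⁻¹ * q ^ J := by
          rw [ENNReal.tsum_mul_left, ENNReal.tsum_geometric]
          ring
  have hlim : Filter.Tendsto (fun J => ENNReal.ofReal (2 * K) * (1 - q)⁻¹ * q ^ J) Filter.atTop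
      (nhds 0) := by
    have h1 := ENNReal.Tendsto.const_mul (a := ENNReal.ofReal (2 * K) * (1 - q)⁻¹)
      (ENNReal.tendsto_pow_atTop_nhds_zero_of_lt_one hq1)
      (Or.inr (ENNReal.mul_ne_top ENNReal.ofReal_ne_top
        (ENNReal.inv_ne_top.2 (tsub_pos_of_lt hq1).ne')))
    simpa using h1
  have hev : ∀ᶠ J : ℕ in Filter.atTop, Real.exp (-2 ^ J) < r₀ :=
    (Real.tendsto_exp_neg_atTop_nhds_zero.comp
      (tendsto_pow_atTop_atTop_of_one_lt one_lt_two)).eventually_lt_const hr₀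
  exact le_antisymm (ge_of_tendsto hlim (hev.mono hbound)) zero_le

lemma LogSigmaThin.hausdorffGaugeMeasure_eq_zero {X : Type*} [MetricSpace X] [MeasurableSpace X]
    [BorelSpace X] {S : Set X} (hS : LogSigmaThin S) {s : ℝ} (hs : 1 < s) :
    hausdorffGaugeMeasure (logGauge s) S = 0 := by
  obtain ⟨t, ht, hSt⟩ := hS.exists_seq
  exact measure_mono_null hSt
    (measure_iUnion_null fun n => (ht n).hausdorffGaugeMeasure_eq_zero hs)

lemma LogSigmaThin.packingGaugeMeasure_eq_zero {X : Type*} [MetricSpace X] {S : Set X}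
    (hS : LogSigmaThin S) {s : ℝ} (hs : 1 < s) : packingGaugeMeasure (logGauge s) S = 0 := by
  obtain ⟨t, ht, hSt⟩ := hS.exists_seq
  refine le_antisymm (iInf₂_le_of_le t hSt ?_) zero_le
  simp [fun n => (ht n).packingPreMeasure_eq_zero hs]

/-- A countable union of log-thin sets has logarithmic Hausdorff dimension at most `1`. -/
lemma LogSigmaThin.logHausdorffDim_le_one {X : Type*} [MetricSpace X] [MeasurableSpace X]
    [BorelSpace X] {S : Set X} (hS : LogSigmaThin S) : logHausdorffDim S ≤ 1 := by
  refine ENNReal.le_of_forall_pos_le_add fun ε hε _ => ?_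
  refine sInf_le ⟨1 + ε, ⟨by positivity, hS.hausdorffGaugeMeasure_eq_zero (by simpa using hε)⟩, ?_⟩
  rw [ENNReal.ofReal_add zero_le_one ε.coe_nonneg]
  simp

/-- A countable union of log-thin sets has logarithmic packing dimension at most `1`. -/
lemma LogSigmaThin.logPackingDim_le_one {X : Type*} [MetricSpace X] {S : Set X}
    (hS : LogSigmaThin S) : logPackingDim S ≤ 1 := by
  refine ENNReal.le_of_forall_pos_le_add fun ε hε _ => ?_
  refine sInf_le ⟨1 + ε, ⟨by positivity, hS.packingGaugeMeasure_eq_zero (by simpa using hε)⟩, ?_⟩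
  rw [ENNReal.ofReal_add zero_le_one ε.coe_nonneg]
  simp

/-! ### From dimension to null sets meeting every affine image -/

/-- If the range of `f` is not a countable union of log-thin sets, then removing all open sets with
small image leaves a nonempty kernel, no relatively open part of which has a log-thin image. -/
lemma exists_kernel_of_not_logSigmaThin {X V : Type*} [TopologicalSpace X]
    [SecondCountableTopology X] [MetricSpace V] {f : X → V} (hf : ¬ LogSigmaThin (range f)) :
    ∃ K : Set X, K.Nonempty ∧
      ∀ U, IsOpen U → (U ∩ K).Nonempty → ¬ LogThin (f '' (U ∩ K)) := by
  let 𝒰 : Set (Set X) := {U | IsOpen U ∧ LogSigmaThin (f '' U)}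
  have hthin : LogSigmaThin (f '' ⋃₀ 𝒰) := by
    obtain ⟨𝒯, h𝒯, hsub, hT⟩ := TopologicalSpace.isOpen_sUnion_countable 𝒰 fun U hU => hU.1
    rw [← hT, image_sUnion]
    refine LogSigmaThin.sUnion (h𝒯.image _) ?_
    rintro _ ⟨U, hU, rfl⟩
    exact (hsub hU).2
  refine ⟨(⋃₀ 𝒰)ᶜ, ?_, ?_⟩
  · by_contra hempty
    rw [not_nonempty_iff_eq_empty, compl_empty_iff] at hempty
    rw [hempty, image_univ] at hthin
    exact hf hthin
  · rintro U hU ⟨x, hxU, hxK⟩ hUK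
    refine hxK ⟨U, ⟨hU, ?_⟩, hxU⟩
    have hpair : LogSigmaThin (⋃₀ {f '' (U ∩ (⋃₀ 𝒰)ᶜ), f '' ⋃₀ 𝒰}) := by
      refine LogSigmaThin.sUnion (by simp) ?_
      rintro S (rfl | rfl)
      · exact hUK.logSigmaThin
      · exact hthin
    refine hpair.mono ?_
    rw [sUnion_pair, ← image_union]
    refine image_mono fun y hy => ?_
    by_cases h : y ∈ ⋃₀ 𝒰
    · exact Or.inr h
    · exact Or.inl ⟨hy, h⟩

lemma exists_closed_null_hit_of_range {V : Type*} [NormedAddCommGroup V] [NormedSpace ℝ V]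
    [FiniteDimensional ℝ V] [MeasurableSpace V] [BorelSpace V] (μ : Measure V)
    [μ.IsAddHaarMeasure] {X : Type*} [TopologicalSpace X] [PolishSpace X] {f : X → V}
    (hf : Continuous f) {R : ℝ} (hR : 1 ≤ R) (hfR : ∀ x, f x ∈ Metric.closedBall 0 R)
    (hthin : ¬ LogSigmaThin (range f)) {M : ℝ} (hM : 1 ≤ M) :
    ∃ C : Set V, IsClosed C ∧ μ C = 0 ∧ ∀ g ∈ boundedAffine V M, ∃ x, g.1 (f x) + g.2 ∈ C := by
  let _ := TopologicalSpace.upgradeIsCompletelyMetrizable X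
  obtain ⟨K, hKne, hK⟩ := exists_kernel_of_not_logSigmaThin hthin
  exact exists_closed_null_hit μ hf hR hfR hKne hK hM

/-- Every nonsingular affine map belongs to one of the bounded families. -/
lemma exists_mem_boundedAffine {V : Type*} [NormedAddCommGroup V] [NormedSpace ℝ V]
    [FiniteDimensional ℝ V] (f : V →ᵃ[ℝ] V) (hf : Function.Bijective f) :
    ∃ (n : ℕ) (g : (V →L[ℝ] V) × V), g ∈ boundedAffine V ((n : ℝ) + 1) ∧
      ∀ x, g.1 x + g.2 = f x := by
  let L : V →L[ℝ] V := LinearMap.toContinuousLinearMap f.linear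
  have hinj : Function.Injective f.linear := f.linear_injective_iff.2 hf.1
  obtain ⟨k, hk, hanti⟩ := f.linear.exists_antilipschitzWith (LinearMap.ker_eq_bot.2 hinj)
  obtain ⟨n, hn⟩ := exists_nat_ge (max (k : ℝ) (max ‖L‖ ‖f 0‖))
  rw [max_le_iff, max_le_iff] at hn
  obtain ⟨h1, h2, h3⟩ := hn
  refine ⟨n, (L, f 0), ⟨by simpa using h2.trans (by linarith),
    by simpa using h3.trans (by linarith), fun x => ?_⟩, fun x => ?_⟩
  · have h4 := hanti.le_mul_dist x 0
    rw [map_zero, dist_zero_right, dist_zero_right] at h4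
    refine h4.trans ?_
    change (k : ℝ) * ‖L x‖ ≤ _
    gcongr
    linarith
  · have := f.map_vadd 0 x
    simpa [L] using this.symm

/-- A Borel set which is not a countable union of log-thin sets admits an `F_σ` null set meeting
all of its nonsingular affine images. -/
lemma exists_isFSigma_null_hit {V : Type*} [NormedAddCommGroup V] [NormedSpace ℝ V]
    [FiniteDimensional ℝ V] [MeasurableSpace V] [BorelSpace V] (μ : Measure V)
    [μ.IsAddHaarMeasure] {A : Set V} (hA : MeasurableSet A) (hthin : ¬ LogSigmaThin A) :
    ∃ B : Set V, IsFSigma B ∧ μ B = 0 ∧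
      ∀ f : V →ᵃ[ℝ] V, Function.Bijective f → ∃ a ∈ A, f a ∈ B := by
  obtain ⟨m, hm⟩ : ∃ m : ℕ, ¬ LogSigmaThin (A ∩ Metric.closedBall 0 ((m : ℝ) + 1)) := by
    by_contra! hall
    refine hthin ((LogSigmaThin.sUnion (countable_range fun m : ℕ =>
      A ∩ Metric.closedBall 0 ((m : ℝ) + 1)) ?_).mono fun x hx => ?_)
    · rintro _ ⟨m, rfl⟩
      exact hall m
    · obtain ⟨m, hm⟩ := exists_nat_ge ‖x‖
      refine ⟨_, ⟨m, rfl⟩, hx, ?_⟩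
      rw [mem_closedBall_zero_iff]
      linarith
  have hana := (hA.inter (Metric.isClosed_closedBall (x := (0 : V))
    (ε := (m : ℝ) + 1)).measurableSet).analyticSet
  rw [AnalyticSet] at hana
  rcases hana with h0 | ⟨φ, hφ, hrange⟩
  · rw [h0] at hm
    exact absurd (LogSigmaThin.mono (T := ∅) ⟨∅, countable_empty, by simp, by simp⟩ Subset.rfl) hm
  have hφA : ∀ x, φ x ∈ A ∩ Metric.closedBall 0 ((m : ℝ) + 1) := fun x =>
    hrange ▸ mem_range_self x
  have hex : ∀ n : ℕ, ∃ C : Set V, IsClosed C ∧ μ C = 0 ∧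
      ∀ g ∈ boundedAffine V ((n : ℝ) + 1), ∃ x, g.1 (φ x) + g.2 ∈ C := fun n =>
    exists_closed_null_hit_of_range μ hφ (R := (m : ℝ) + 1) (by simp) (fun x => (hφA x).2)
      (by rwa [hrange]) (by simp)
  choose C hC hμC hhit using hex
  refine ⟨⋃ n, C n, ⟨C, hC, rfl⟩, measure_iUnion_null hμC, fun f hf => ?_⟩
  obtain ⟨n, g, hg, hgf⟩ := exists_mem_boundedAffine f hf
  obtain ⟨x, hx⟩ := hhit n g hg
  exact ⟨φ x, (hφA x).1, mem_iUnion.2 ⟨n, hgf _ ▸ hx⟩⟩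

theorem mainTheorem1 (d : ℕ) (A : Set (EuclideanSpace ℝ (Fin d))) (hA : MeasurableSet A)
    (hdim : 2 < logPackingDim A ∨ 1 < logHausdorffDim A) :
    (∃ B : Set (EuclideanSpace ℝ (Fin d)), IsFSigma B ∧ volume B = 0 ∧
      (∀ f : EuclideanSpace ℝ (Fin d) →ᵃ[ℝ] EuclideanSpace ℝ (Fin d),
        Function.Bijective f → f '' A + B = univ) ∧
      IsGδ (-B)ᶜ ∧ Dense (-B)ᶜ ∧ volume ((-B)ᶜ)ᶜ = 0 ∧
      ∀ f : EuclideanSpace ℝ (Fin d) →ᵃ[ℝ] EuclideanSpace ℝ (Fin d),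
        Function.Bijective f → ¬ f '' A ⊆ (-B)ᶜ) ∧
    ¬ IsFullMeasureUniversal A := by
  have hthin : ¬ LogSigmaThin A := fun h => by
    rcases hdim with h2 | h1
    · exact absurd (h2.trans_le h.logPackingDim_le_one) (by norm_num)
    · exact absurd h.logHausdorffDim_le_one (not_le.2 h1)
  obtain ⟨B, hB, hμB, hhit⟩ := exists_isFSigma_null_hit volume hA hthin
  have hnull : volume ((-B)ᶜ)ᶜ = 0 := by
    rw [compl_compl, Measure.measure_neg]
    exact hμB
  have hneg : ∀ f : EuclideanSpace ℝ (Fin d) →ᵃ[ℝ] EuclideanSpace ℝ (Fin d),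
      Function.Bijective f → ¬ f '' A ⊆ (-B)ᶜ := by
    intro f hf hsub
    obtain ⟨a, ha, haB⟩ := hhit (-f) (neg_involutive.bijective.comp hf)
    exact hsub (mem_image_of_mem f ha) haB
  refine ⟨⟨B, hB, hμB, fun f hf => eq_univ_of_forall fun x => ?_, ?_, ?_, hnull, hneg⟩,
    fun huniv => ?_⟩
  · -- `x ∈ f '' A + B` says that `B` meets the image of `A` under `y ↦ x - f y`
    obtain ⟨a, ha, haB⟩ := hhit (AffineMap.const ℝ _ x - f)
      ((Equiv.subLeft x).bijective.comp hf)
    exact ⟨f a, mem_image_of_mem f ha, x - f a, haB, by simp⟩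
  · obtain ⟨F, hF, rfl⟩ := hB
    rw [isGδ_iff_eq_iInter_nat]
    refine ⟨fun n => (-F n)ᶜ, fun n => (hF n).neg.isOpen_compl, ?_⟩
    rw [← compl_iUnion, iUnion_neg]
  · exact Measure.dense_of_ae (μ := volume) (mem_ae_iff.2 hnull)
  · obtain ⟨f, hf, hsub⟩ := huniv _ hnull
    exact hneg f hf hsub
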